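/- A pseudoline arrangement in the real projective plane $\mathbb{P}^2$ is a finite set of simple closed curves in $\mathbb{P}^2$, any two of which meet in exactly one point, at which they cross. A vertex of an arrangement $L$ is a point lying on at least two of its members, and $r(L)$ denotes the maximum number of vertices of $L$ on a member of $L$. For every positive integer $j$ there is an arrangement of $n = 18j+7$ pseudolines in $\mathbb{P}^2$, not all passing through a single point, such that no pseudoline of the arrangement is incident to more than $8j+2 = \frac{4n}{9} - \frac{10}{9}$ vertices. Consequently the Strong Dirac conjecture fails for pseudolines: there is no constant $c$ such that $r(L) \ge n/2 - c$ for every $n$ and every arrangement $L$ of $n$ pseudolines in $\mathbb{P}^2$ that do not all pass through a single point. -/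

import Mathlib

open scoped LinearAlgebra.Projectivization

/-- The real projective plane: lines through the origin of `ℝ³`. -/
abbrev RealProjectivePlane : Type := ℙ ℝ (Fin 3 → ℝ)

/-- The real projective plane carries the quotient topology from `ℝ³ ∖ {0}`. -/
noncomputable instance RealProjectivePlane.instTopologicalSpace : TopologicalSpace RealProjectivePlane :=
  TopologicalSpace.coinduced
    (Projectivization.mk' ℝ : {v : Fin 3 → ℝ // v ≠ 0} → RealProjectivePlane) inferInstance

/-- A simple closed curve: the image of the circle under a continuous injective map. -/
def IsSimpleClosedCurve {X : Type*} [TopologicalSpace X] (C : Set X) : Prop :=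
  ∃ γ : Circle → X, Continuous γ ∧ Function.Injective γ ∧ Set.range γ = C

/-- The curves `C` and `D` in a surface cross at the point `p`: in suitable local coordinates
centred at `p`, the curve `C` is the horizontal axis and the curve `D` is the vertical axis. -/
def CrossAt {X : Type*} [TopologicalSpace X] (C D : Set X) (p : X) : Prop :=
  ∃ e : OpenPartialHomeomorph X (ℝ × ℝ), p ∈ e.source ∧ e p = (0, 0) ∧
    ∀ q ∈ e.source, (q ∈ C ↔ (e q).2 = 0) ∧ (q ∈ D ↔ (e q).1 = 0)

/-- A (finite) arrangement of pseudolines in the real projective plane: a set of simple closed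
curves, any two of which have exactly one point in common, at which they cross. -/
def IsPseudolineArrangement (L : Finset (Set RealProjectivePlane)) : Prop :=
  (∀ C ∈ L, IsSimpleClosedCurve C) ∧
    ∀ C ∈ L, ∀ D ∈ L, C ≠ D → ∃ p, C ∩ D = {p} ∧ CrossAt C D p

/-- All members of `L` pass through a single point. -/
def IsPencil (L : Finset (Set RealProjectivePlane)) : Prop :=
  ∃ p, ∀ C ∈ L, p ∈ C

/-- The vertices of `L`: the points lying on at least two members. -/
def arrangementVertices (L : Finset (Set RealProjectivePlane)) : Set RealProjectivePlane :=
  {p | ∃ C ∈ L, ∃ D ∈ L, C ≠ D ∧ p ∈ C ∧ p ∈ D}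

/-- An arrangement has finitely many vertices, so that counting them with `Set.ncard` is
meaningful. -/
theorem IsPseudolineArrangement.finite_vertices {L : Finset (Set RealProjectivePlane)}
    (hL : IsPseudolineArrangement L) : (arrangementVertices L).Finite := by
  have h : arrangementVertices L ⊆ ⋃ C ∈ L, ⋃ D ∈ L, {p | C ≠ D ∧ p ∈ C ∧ p ∈ D} := by
    rintro p ⟨C, hC, D, hD, hp⟩
    simp only [Set.mem_iUnion]
    exact ⟨C, hC, D, hD, hp⟩
  refine Set.Finite.subset ?_ h
  refine L.finite_toSet.biUnion fun C hC => L.finite_toSet.biUnion fun D hD => ?_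
  by_cases hCD : C = D
  · simp [hCD]
  · obtain ⟨p, hp, -⟩ := hL.2 C hC D hD hCD
    refine (Set.finite_singleton p).subset fun q hq => ?_
    rw [← hp]
    exact hq.2

/-- The number of vertices of `L` on the curve `C`. -/
noncomputable def vertexCount (L : Finset (Set RealProjectivePlane))
    (C : Set RealProjectivePlane) : ℕ :=
  (arrangementVertices L ∩ C).ncard

/-- `r(L)`: the maximum number of vertices of `L` on a member of `L`. -/
noncomputable def maxVertexCount (L : Finset (Set RealProjectivePlane)) : ℕ :=
  L.sup (vertexCount L)

namespace PseudolineExample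

open Real Set

/-! ### Curves and charts in the real projective plane -/

/-! Put κ = 3j + 1. A point other than the origin has a direction φ and an inverse distance s, with
(φ + π, -s) and (φ, s) the same point. A continuous π-antiperiodic f thus gives a simple closed
curve s = f φ; two such curves meet where the functions agree and cross where the difference is
strictly monotone. With angles measured in units of π/(2κ), the arrangement has 2κ lines through the
origin at the integral angles, the line at infinity s = 0, and two families of 2κ triangle waves, of
amplitude ratio 3 : 1, with peaks at the even integers: 6κ + 1 = 18j + 7 members. Waves of equal
amplitude meet once, halfway between their peaks (`crossOnce_wave_of_ne`); for unequal amplitudes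
the steeper slope dominates and again gives one crossing (`crossOnce_wave_of_lt`).

The saving is that nearly all crossings on a wave occur at integral angles, of which there are 2κ =
6j + 2 modulo π. Only a steep and a shallow wave on opposite slopes can meet elsewhere, and then at
a half-integral angle within κ/3 = j + 1/3 of a zero of the steep wave, which leaves 2j angles
(`exists_of_three_mul_tri_eq`). Hence at most 8j + 2 vertices per wave. On a line through the
origin, parity leaves about κ heights per family (`exists_finset_heights`). Since 8/18 < 1/2, no
constant c can work. -/

theorem isQuotientMap_mk' : Topology.IsQuotientMap
    (Projectivization.mk' ℝ : {v : Fin 3 → ℝ // v ≠ 0} → RealProjectivePlane) :=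
  ⟨⟨rfl⟩, fun p => ⟨⟨p.rep, p.rep_nonzero⟩, by simp [Projectivization.mk'_eq_mk, p.mk_rep]⟩⟩

theorem continuous_projectivization_mk {X : Type*} [TopologicalSpace X] {f : X → Fin 3 → ℝ}
    (hf : Continuous f) (h0 : ∀ x, f x ≠ 0) :
    Continuous fun x => (Projectivization.mk ℝ (f x) (h0 x) : RealProjectivePlane) :=
  isQuotientMap_mk'.continuous.comp (hf.subtype_mk h0)

/-- `γ` descends to the circle ℝ/πℤ. The period is π because a half-turn already returns to the same
projective point. -/
theorem isSimpleClosedCurve_range {X : Type*} [TopologicalSpace X] {γ : ℝ → X}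
    (hγ : Continuous γ) (hp : Function.Periodic γ π)
    (hinj : ∀ x y, γ x = γ y → ∃ n : ℤ, y = x + n * π) : IsSimpleClosedCurve (range γ) := by
  let e := AddCircle.homeomorphCircle (T := π) pi_ne_zero
  have hc : Continuous hp.lift := continuous_coinduced_dom.2 hγ
  refine ⟨hp.lift ∘ e.symm, hc.comp e.symm.continuous, ?_, ?_⟩
  · refine Function.Injective.comp ?_ e.symm.injective
    intro a b
    induction a using QuotientAddGroup.induction_on with
    | H a =>
      induction b using QuotientAddGroup.induction_on with
      | H b =>
        intro hab
        obtain ⟨n, hn⟩ := hinj a b hab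
        refine (QuotientAddGroup.eq).2 ?_
        exact AddSubgroup.mem_zmultiples_iff.2 ⟨n, by rw [hn, zsmul_eq_mul]; ring⟩
  · rw [range_comp, e.symm.surjective.range_eq, image_univ]
    ext p
    constructor
    · rintro ⟨a, rfl⟩
      induction a using QuotientAddGroup.induction_on with
      | H a => exact ⟨a, rfl⟩
    · rintro ⟨a, rfl⟩
      exact ⟨(a : AddCircle π), rfl⟩

theorem crossAt_symm {X : Type*} [TopologicalSpace X] {C D : Set X} {p : X}
    (h : CrossAt C D p) : CrossAt D C p := by
  obtain ⟨e, hp, h0, he⟩ := h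
  refine ⟨e.transHomeomorph (Homeomorph.prodComm ℝ ℝ), hp, by simp [h0], fun q hq => ?_⟩
  simpa using (he q hq).symm

section AffineChart

variable (A : (Fin 3 → ℝ) ≃ₗ[ℝ] (Fin 3 → ℝ))

theorem symm_vec_ne_zero (x : ℝ × ℝ) : A.symm ![x.1, x.2, 1] ≠ 0 := by
  intro h
  rw [LinearEquiv.map_eq_zero_iff] at h
  simpa using congrFun h 2

/-- The arbitrary representative `rep` is a nonzero multiple of `v`, so ratios and homogeneous
conditions can be read off `v`. -/
theorem exists_apply_mk_rep (v : Fin 3 → ℝ) (hv : v ≠ 0) :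
    ∃ a : ℝ, a ≠ 0 ∧ ∀ i, A (Projectivization.mk ℝ v hv).rep i = a * A v i := by
  obtain ⟨a, ha⟩ := Projectivization.exists_smul_eq_mk_rep ℝ v hv
  refine ⟨a, a.ne_zero, fun i => ?_⟩
  rw [← ha, Units.smul_def, map_smul]
  simp

/-- The affine chart `[v] ↦ ((Av)₀ / (Av)₂, (Av)₁ / (Av)₂)` of the projective plane. -/
noncomputable def affineChart : OpenPartialHomeomorph RealProjectivePlane (ℝ × ℝ) where
  toFun p := (A p.rep 0 / A p.rep 2, A p.rep 1 / A p.rep 2)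
  invFun x := Projectivization.mk ℝ (A.symm ![x.1, x.2, 1]) (symm_vec_ne_zero A x)
  source := {p | A p.rep 2 ≠ 0}
  target := univ
  map_source' _ _ := mem_univ _
  map_target' x _ := by
    obtain ⟨a, ha, h⟩ := exists_apply_mk_rep A _ (symm_vec_ne_zero A x)
    simpa [h] using ha
  left_inv' p hp := by
    have hp : A p.rep 2 ≠ 0 := hp
    conv_rhs => rw [← p.mk_rep]
    rw [Projectivization.mk_eq_mk_iff']
    refine ⟨(A p.rep 2)⁻¹, ?_⟩
    rw [LinearEquiv.eq_symm_apply, map_smul]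
    ext i
    fin_cases i
    · simp; ring
    · simp; ring
    · simp [hp]
  right_inv' x _ := by
    obtain ⟨a, ha, h⟩ := exists_apply_mk_rep A _ (symm_vec_ne_zero A x)
    ext <;> simp [h, ha]
  open_source := by
    rw [← isQuotientMap_mk'.isOpen_preimage]
    have hA : Continuous A := A.toContinuousLinearEquiv.continuous
    have : Projectivization.mk' ℝ ⁻¹' {p : RealProjectivePlane | A p.rep 2 ≠ 0} =
        {v : {v : Fin 3 → ℝ // v ≠ 0} | A v 2 ≠ 0} := by
      ext v
      obtain ⟨a, ha, h⟩ := exists_apply_mk_rep A v.1 v.2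
      simp [h, ha, Projectivization.mk'_eq_mk]
    rw [this]
    exact isOpen_ne.preimage ((continuous_apply 2).comp (hA.comp continuous_subtype_val))
  open_target := isOpen_univ
  continuousOn_toFun := by
    have hA : Continuous A := A.toContinuousLinearEquiv.continuous
    have hpre : Projectivization.mk' ℝ ⁻¹' {p : RealProjectivePlane | A p.rep 2 ≠ 0} =
        {v : {v : Fin 3 → ℝ // v ≠ 0} | A v 2 ≠ 0} := by
      ext v
      obtain ⟨a, ha, h⟩ := exists_apply_mk_rep A v.1 v.2
      simp [h, ha, Projectivization.mk'_eq_mk]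
    have ho : IsOpen {p : RealProjectivePlane | A p.rep 2 ≠ 0} := by
      rw [← isQuotientMap_mk'.isOpen_preimage, hpre]
      exact isOpen_ne.preimage ((continuous_apply 2).comp (hA.comp continuous_subtype_val))
    rw [isQuotientMap_mk'.continuousOn_isOpen_iff ho, hpre]
    have hi : ∀ i, Continuous fun v : {v : Fin 3 → ℝ // v ≠ 0} => A v i := fun i =>
      (continuous_apply i).comp (hA.comp continuous_subtype_val)
    have hc : ContinuousOn (fun v : {v : Fin 3 → ℝ // v ≠ 0} => (A v 0 / A v 2, A v 1 / A v 2))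
        {v | A v 2 ≠ 0} :=
      ((hi 0).continuousOn.div (hi 2).continuousOn fun _ h => h).prodMk
        ((hi 1).continuousOn.div (hi 2).continuousOn fun _ h => h)
    refine hc.congr fun v hv => ?_
    obtain ⟨a, ha, h⟩ := exists_apply_mk_rep A v.1 v.2
    simp [h, Projectivization.mk'_eq_mk, mul_div_mul_left _ _ ha]
  continuousOn_invFun := by
    have hA : Continuous A.symm := A.symm.toContinuousLinearEquiv.continuous
    refine Continuous.continuousOn (continuous_projectivization_mk (hA.comp ?_) _)
    refine continuous_pi fun i => ?_
    fin_cases i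
    · exact continuous_fst
    · exact continuous_snd
    · exact continuous_const

/-- Two curves cross at `p` if they do so in an affine chart, after a homeomorphism of `ℝ²`. -/
theorem crossAt_of_affineChart {C D : Set RealProjectivePlane} (H : (ℝ × ℝ) ≃ₜ (ℝ × ℝ))
    {U : Set (ℝ × ℝ)} (hU : IsOpen U) {x₀ : ℝ × ℝ} (hx₀ : x₀ ∈ U) (hH : H x₀ = (0, 0))
    (hC : ∀ x ∈ U, (affineChart A).symm x ∈ C ↔ (H x).2 = 0)
    (hD : ∀ x ∈ U, (affineChart A).symm x ∈ D ↔ (H x).1 = 0) :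
    CrossAt C D ((affineChart A).symm x₀) := by
  have ht : ∀ x, x ∈ (affineChart A).target := fun _ => mem_univ _
  have hs := (affineChart A).isOpen_inter_preimage hU
  refine ⟨((affineChart A).transHomeomorph H).restrOpen _ hs, ?_, ?_, fun q hq => ?_⟩
  · have := (affineChart A).map_target (ht x₀)
    simp [this, (affineChart A).right_inv (ht x₀), hx₀]
  · simp [(affineChart A).right_inv (ht x₀), hH]
  · simp only [OpenPartialHomeomorph.restrOpen_source,
      OpenPartialHomeomorph.transHomeomorph_source, mem_inter_iff, mem_preimage] at hq
    have h1 := hC _ hq.2.2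
    have h2 := hD _ hq.2.2
    rw [(affineChart A).left_inv hq.1] at h1 h2
    exact ⟨by simpa using h1, by simpa using h2⟩

end AffineChart

/-! ### Polar coordinates -/

theorem polar_vec_ne_zero (φ s : ℝ) : ![cos φ, sin φ, s] ≠ 0 := by
  intro h
  have h0 : cos φ = 0 := by simpa using congrFun h 0
  have h1 : sin φ = 0 := by simpa using congrFun h 1
  simpa [h0, h1] using sin_sq_add_cos_sq φ

/-- The point in direction `φ` at inverse distance `s` from the origin of the affine plane. -/
noncomputable def polar (φ s : ℝ) : RealProjectivePlane :=
  Projectivization.mk ℝ ![cos φ, sin φ, s] (polar_vec_ne_zero φ s)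

/-- The origin of the affine plane. -/
noncomputable def origin : RealProjectivePlane :=
  Projectivization.mk ℝ ![0, 0, 1] fun h => by simpa using congrFun h 2

theorem polar_ne_origin (φ s : ℝ) : polar φ s ≠ origin := by
  intro h
  obtain ⟨a, ha⟩ := (Projectivization.mk_eq_mk_iff' ..).1 h
  refine polar_vec_ne_zero φ 0 ?_
  ext i
  fin_cases i
  · simpa using (congrFun ha 0).symm
  · simpa using (congrFun ha 1).symm
  · rfl

/-- This identification is why antiperiodic functions are the ones that define closed curves. -/
theorem polar_add_pi (φ s : ℝ) : polar (φ + π) (-s) = polar φ s := by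
  refine (Projectivization.mk_eq_mk_iff' ..).2 ⟨-1, ?_⟩
  ext i
  fin_cases i <;> simp

theorem exists_of_polar_eq {φ ψ s t : ℝ} (h : polar φ s = polar ψ t) :
    ∃ n : ℤ, ψ = φ + n * π := by
  obtain ⟨a, ha⟩ := (Projectivization.mk_eq_mk_iff' ..).1 h
  have h0 : a * cos ψ = cos φ := by simpa using congrFun ha 0
  have h1 : a * sin ψ = sin φ := by simpa using congrFun ha 1
  have : sin (ψ - φ) = 0 := by rw [sin_sub, ← h0, ← h1]; ring
  obtain ⟨n, hn⟩ := sin_eq_zero_iff.1 this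
  exact ⟨n, by linarith⟩

theorem polar_right_injective (φ : ℝ) : Function.Injective (polar φ) := by
  intro s t h
  obtain ⟨a, ha⟩ := (Projectivization.mk_eq_mk_iff' ..).1 h
  have h0 : a * cos φ = cos φ := by simpa using congrFun ha 0
  have h1 : a * sin φ = sin φ := by simpa using congrFun ha 1
  have h2 : a * t = s := by simpa using congrFun ha 2
  have ha : a = 1 := by
    have := sin_sq_add_cos_sq φ
    linear_combination (1 - a) * this + sin φ * h1 + cos φ * h0
  rw [← h2, ha, one_mul]

theorem eq_origin_or_exists_polar (p : RealProjectivePlane) :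
    p = origin ∨ ∃ φ s, p = polar φ s := by
  induction p using Projectivization.ind with
  | h v hv =>
    by_cases h : v 0 = 0 ∧ v 1 = 0
    · left
      refine (Projectivization.mk_eq_mk_iff' ..).2 ⟨v 2, ?_⟩
      ext i
      fin_cases i <;> simp [h.1, h.2]
    · right
      set z : ℂ := ⟨v 0, v 1⟩
      have hz : z ≠ 0 := by
        intro h0
        exact h ⟨congrArg Complex.re h0, congrArg Complex.im h0⟩
      have hn : ‖z‖ ≠ 0 := norm_ne_zero_iff.2 hz
      refine ⟨Complex.arg z, v 2 / ‖z‖, (Projectivization.mk_eq_mk_iff' ..).2 ⟨‖z‖, ?_⟩⟩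
      ext i
      fin_cases i
      · simp [z, Complex.norm_mul_cos_arg z]
      · simp [z, Complex.norm_mul_sin_arg z]
      · simp; field_simp

theorem polar_apply_periodic {f : ℝ → ℝ} (hf : Function.Antiperiodic f π) :
    Function.Periodic (fun φ => polar φ (f φ)) π := fun φ => by
  simp only [hf φ, polar_add_pi]

/-- The curve with polar equation `s = f φ`. -/
def polarCurve (f : ℝ → ℝ) : Set RealProjectivePlane :=
  range fun φ => polar φ (f φ)

theorem polar_mem_polarCurve {f : ℝ → ℝ} (hf : Function.Antiperiodic f π) (φ s : ℝ) :
    polar φ s ∈ polarCurve f ↔ s = f φ := by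
  constructor
  · rintro ⟨ψ, h⟩
    obtain ⟨n, hn⟩ := exists_of_polar_eq h
    have := (polar_apply_periodic hf).int_mul n ψ
    simp only [← hn] at this
    exact polar_right_injective φ (h.symm.trans this.symm)
  · rintro rfl
    exact ⟨φ, rfl⟩

theorem origin_notMem_polarCurve (f : ℝ → ℝ) : origin ∉ polarCurve f := by
  rintro ⟨φ, h⟩
  exact polar_ne_origin _ _ h

theorem isSimpleClosedCurve_polarCurve {f : ℝ → ℝ} (hc : Continuous f)
    (hf : Function.Antiperiodic f π) : IsSimpleClosedCurve (polarCurve f) := by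
  refine isSimpleClosedCurve_range ?_ (polar_apply_periodic hf) fun x y h => exists_of_polar_eq h
  refine continuous_projectivization_mk (continuous_pi fun i => ?_) _
  fin_cases i
  · exact continuous_cos
  · exact continuous_sin
  · exact hc

/-- The line through the origin in direction `θ`. -/
def radialLine (θ : ℝ) : Set RealProjectivePlane :=
  {p | p.rep 1 * cos θ = p.rep 0 * sin θ}

theorem mk_mem_radialLine {θ : ℝ} {v : Fin 3 → ℝ} (hv : v ≠ 0) :
    Projectivization.mk ℝ v hv ∈ radialLine θ ↔ v 1 * cos θ = v 0 * sin θ := by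
  obtain ⟨a, ha, h⟩ := exists_apply_mk_rep (LinearEquiv.refl ℝ _) v hv
  simp only [LinearEquiv.refl_apply] at h
  simp only [radialLine, mem_ofPred_eq, h, mul_assoc, mul_right_inj' ha]

theorem origin_mem_radialLine (θ : ℝ) : origin ∈ radialLine θ := by
  rw [origin, mk_mem_radialLine]; simp

theorem polar_mem_radialLine {θ φ s : ℝ} :
    polar φ s ∈ radialLine θ ↔ ∃ n : ℤ, φ = θ + n * π := by
  rw [polar, mk_mem_radialLine]
  have : sin (φ - θ) = 0 ↔ sin φ * cos θ = cos φ * sin θ := by rw [sin_sub, sub_eq_zero]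
  simp only [Matrix.cons_val_one, Matrix.cons_val_zero]
  rw [← this, sin_eq_zero_iff]
  constructor
  · rintro ⟨n, hn⟩
    exact ⟨n, by linarith⟩
  · rintro ⟨n, hn⟩
    exact ⟨n, by linarith⟩

theorem radial_vec_ne_zero (θ ψ : ℝ) : ![cos ψ * cos θ, cos ψ * sin θ, sin ψ] ≠ 0 := by
  intro h
  have h0 : cos ψ * cos θ = 0 := by simpa using congrFun h 0
  have h1 : cos ψ * sin θ = 0 := by simpa using congrFun h 1
  have h2 : sin ψ = 0 := by simpa using congrFun h 2
  have h3 : cos ψ = 0 := by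
    linear_combination cos θ * h0 + sin θ * h1 - cos ψ * sin_sq_add_cos_sq θ
  simpa [h2, h3] using sin_sq_add_cos_sq ψ

theorem isSimpleClosedCurve_radialLine (θ : ℝ) : IsSimpleClosedCurve (radialLine θ) := by
  let γ : ℝ → RealProjectivePlane := fun ψ => Projectivization.mk ℝ _ (radial_vec_ne_zero θ ψ)
  have hγ : range γ = radialLine θ := by
    ext p
    constructor
    · rintro ⟨ψ, rfl⟩
      simp only [γ, mk_mem_radialLine, Matrix.cons_val_one, Matrix.cons_val_zero]
      ring
    · intro hp
      obtain rfl | ⟨φ, s, rfl⟩ := eq_origin_or_exists_polar p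
      · refine ⟨π / 2, (Projectivization.mk_eq_mk_iff' ..).2 ⟨1, ?_⟩⟩
        simp
      · obtain ⟨n, rfl⟩ := polar_mem_radialLine.1 hp
        have hs : (0 : ℝ) < √(1 + s ^ 2) := by positivity
        have hpm : cos (n * π) = 1 ∨ cos (n * π) = -1 := by
          rw [cos_int_mul_pi]
          exact (Int.even_or_odd n).imp Even.neg_one_zpow Odd.neg_one_zpow
        have hsn : sin (n * π) = 0 := sin_int_mul_pi n
        have hcc : cos (n * π) * cos (n * π) = 1 := by rcases hpm with h | h <;> rw [h] <;> norm_num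
        -- The parameter solves tan ψ = ±s, where the sign cos (nπ) undoes the n half-turns.
        refine ⟨arctan (s * cos (n * π)), (Projectivization.mk_eq_mk_iff' ..).2
          ⟨cos (arctan (s * cos (n * π))) * cos (n * π), ?_⟩⟩
        have ht := tan_mul_cos (cos_arctan_pos (s * cos (n * π))).ne'
        rw [tan_arctan] at ht
        ext i
        fin_cases i
        · simp only [cos_add, hsn]
          simp
          linear_combination cos (arctan (s * cos (n * π))) * cos θ * hcc
        · simp only [sin_add, hsn]
          simp
          linear_combination cos (arctan (s * cos (n * π))) * sin θ * hcc
        · simp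
          linear_combination ht
  rw [← hγ]
  refine isSimpleClosedCurve_range ?_ ?_ ?_
  · refine continuous_projectivization_mk (continuous_pi fun i => ?_) _
    fin_cases i
    · exact continuous_cos.mul continuous_const
    · exact continuous_cos.mul continuous_const
    · exact continuous_sin
  · intro ψ
    refine (Projectivization.mk_eq_mk_iff' ..).2 ⟨-1, ?_⟩
    ext i
    fin_cases i <;> simp
  · intro x y h
    obtain ⟨a, ha⟩ := (Projectivization.mk_eq_mk_iff' ..).1 h
    have h0 : a * (cos y * cos θ) = cos x * cos θ := by simpa using congrFun ha 0
    have h1 : a * (cos y * sin θ) = cos x * sin θ := by simpa using congrFun ha 1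
    have h2 : a * sin y = sin x := by simpa using congrFun ha 2
    have h3 : a * cos y = cos x := by
      linear_combination cos θ * h0 + sin θ * h1 + (cos x - a * cos y) * sin_sq_add_cos_sq θ
    have : sin (y - x) = 0 := by rw [sin_sub, ← h2, ← h3]; ring
    obtain ⟨n, hn⟩ := sin_eq_zero_iff.1 this
    exact ⟨n, by linarith⟩

/-! ### Local crossings -/

section Planar

/-- A function that is continuous and strictly increasing near `0` agrees near `0` with a
homeomorphism of the line. -/
theorem exists_homeomorph_eqOn {g : ℝ → ℝ} (hg : Continuous g) {δ : ℝ} (hδ : 0 < δ)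
    (hmono : StrictMonoOn g (Icc (-δ) δ)) :
    ∃ e : ℝ ≃ₜ ℝ, ∀ t ∈ Icc (-δ) δ, e t = g t := by
  -- Clamping freezes `g` outside the interval; adding `t - cl t` then continues it with slope 1.
  let cl : ℝ → ℝ := fun t => max (-δ) (min t δ)
  have hclm : Monotone cl := fun a b h => max_le_max le_rfl (min_le_min h le_rfl)
  have hcl : ∀ t, cl t ∈ Icc (-δ) δ := fun t =>
    ⟨le_max_left _ _, max_le (by linarith) (min_le_right _ _)⟩
  have hclc : Continuous cl := continuous_const.max (continuous_id.min continuous_const)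
  have hid : Monotone fun t => t - cl t := by
    intro a b h
    simp only [cl]
    rcases max_cases (-δ) (min a δ) with ⟨h1, h2⟩ | ⟨h1, h2⟩ <;>
    rcases max_cases (-δ) (min b δ) with ⟨h3, h4⟩ | ⟨h3, h4⟩ <;>
    rcases min_cases a δ with ⟨h5, h6⟩ | ⟨h5, h6⟩ <;>
    rcases min_cases b δ with ⟨h7, h8⟩ | ⟨h7, h8⟩ <;> linarith
  let G : ℝ → ℝ := fun t => g (cl t) + (t - cl t)
  have hG : StrictMono G := by
    intro a b h
    rcases (hclm h.le).lt_or_eq with h1 | h1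
    · exact add_lt_add_of_lt_of_le (hmono (hcl a) (hcl b) h1) (hid h.le)
    · simp only [G, h1]
      linarith
  have hGc : Continuous G := (hg.comp hclc).add (continuous_id.sub hclc)
  have hlo : ∀ t, t + (g (-δ) - δ) ≤ G t := fun t => by
    have h1 := hmono.monotoneOn ⟨le_rfl, by linarith⟩ (hcl t) (hcl t).1
    have := (hcl t).2
    simp only [G]; linarith
  have hhi : ∀ t, G t ≤ t + (g δ + δ) := fun t => by
    have h1 := hmono.monotoneOn (hcl t) ⟨by linarith, le_rfl⟩ (hcl t).2
    have := (hcl t).1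
    simp only [G]; linarith
  have hs : Function.Surjective G := hGc.surjective
    (Filter.tendsto_atTop_mono hlo (Filter.tendsto_atTop_add_const_right _ _ Filter.tendsto_id))
    (Filter.tendsto_atBot_mono hhi (Filter.tendsto_atBot_add_const_right _ _ Filter.tendsto_id))
  refine ⟨(hG.orderIsoOfSurjective G hs).toHomeomorph, fun t ht => ?_⟩
  have : cl t = t := by simp [cl, min_eq_left ht.2, max_eq_right ht.1]
  simp [G, this]

/-- Straightening of two transversal graphs, in coordinates where heights are weighted. -/
noncomputable def straighten (e : ℝ ≃ₜ ℝ) {c F : ℝ → ℝ} (hc : Continuous c) (hF : Continuous F)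
    (hc0 : ∀ t, c t ≠ 0) (ε : ℝ) : (ℝ × ℝ) ≃ₜ (ℝ × ℝ) where
  toFun x := (ε * (x.2 * c x.1 - F x.1) + e x.1, x.2 * c x.1 - F x.1)
  invFun x := (e.symm (x.1 - ε * x.2),
    (x.2 + F (e.symm (x.1 - ε * x.2))) / c (e.symm (x.1 - ε * x.2)))
  left_inv x := by ext <;> simp [hc0]
  right_inv x := by ext <;> simp [hc0]
  continuous_toFun := by fun_prop
  continuous_invFun := by fun_prop (disch := simp [hc0])

end Planar

/-- The linear equivalence underlying the affine chart around the direction `θ`. -/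
noncomputable def directionEquiv (θ : ℝ) : (Fin 3 → ℝ) ≃ₗ[ℝ] (Fin 3 → ℝ) where
  toFun v := ![cos θ * v 1 - sin θ * v 0, v 2, cos θ * v 0 + sin θ * v 1]
  invFun w := ![cos θ * w 2 - sin θ * w 0, sin θ * w 2 + cos θ * w 0, w 1]
  map_add' v w := by ext i; fin_cases i <;> simp <;> ring
  map_smul' a v := by ext i; fin_cases i <;> simp <;> ring
  left_inv v := by
    ext i
    fin_cases i
    · simp; linear_combination v 0 * sin_sq_add_cos_sq θ
    · simp; linear_combination v 1 * sin_sq_add_cos_sq θ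
    · simp
  right_inv v := by
    ext i
    fin_cases i
    · simp; linear_combination v 0 * sin_sq_add_cos_sq θ
    · simp
    · simp; linear_combination v 2 * sin_sq_add_cos_sq θ

/-- The first coordinate is the tangent of the angle from θ. The cosine that turns the second into
an inverse distance is the weight `c` of `straighten`. -/
theorem affineChart_directionEquiv_symm (θ : ℝ) (x : ℝ × ℝ) :
    (affineChart (directionEquiv θ)).symm x =
      polar (θ + arctan x.1) (x.2 * cos (arctan x.1)) := by
  have ht := tan_mul_cos (cos_arctan_pos x.1).ne'
  rw [tan_arctan] at ht
  have hc := (cos_arctan_pos x.1).ne'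
  refine (Projectivization.mk_eq_mk_iff' ..).2 ⟨(cos (arctan x.1))⁻¹, ?_⟩
  ext i
  fin_cases i
  · simp [directionEquiv, cos_add, ← ht]; field_simp
  · simp [directionEquiv, sin_add, ← ht]; field_simp
  · simp [directionEquiv]; field_simp

theorem abs_arctan_le {t δ : ℝ} (h : |t| ≤ δ) : |arctan t| ≤ δ := by
  have key : ∀ s : ℝ, 0 ≤ s → arctan s ≤ s := fun s hs => by
    have := le_tan (arctan_nonneg.2 hs) (arctan_lt_pi_div_two s)
    rwa [tan_arctan] at this
  refine le_trans ?_ h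
  rcases le_total 0 t with ht | ht
  · rw [abs_of_nonneg ht, abs_of_nonneg (arctan_nonneg.2 ht)]
    exact key t ht
  · have h1 := key (-t) (by linarith)
    have h2 : 0 ≤ arctan (-t) := arctan_nonneg.2 (by linarith)
    rw [arctan_neg] at h1 h2
    rw [abs_of_nonpos ht, abs_of_nonpos (by linarith)]
    exact h1

/-- The straightened coordinates are s - g and s - f. Their difference f - g depends on the angle
alone and, being strictly monotone, can replace it as a local coordinate. -/
theorem crossAt_polarCurve {f g : ℝ → ℝ} (hf : Continuous f) (hg : Continuous g)
    (hfa : Function.Antiperiodic f π) (hga : Function.Antiperiodic g π) {θ δ : ℝ} (hδ : 0 < δ)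
    (h0 : f θ = g θ) (hmono : StrictMonoOn (fun φ => f φ - g φ) (Icc (θ - δ) (θ + δ))) :
    CrossAt (polarCurve f) (polarCurve g) (polar θ (f θ)) := by
  have hFc : Continuous fun t => f (θ + arctan t) := by fun_prop
  have hGc : Continuous fun t => g (θ + arctan t) := by fun_prop
  have hcc : Continuous fun t => cos (arctan t) := by fun_prop
  obtain ⟨e, he⟩ := exists_homeomorph_eqOn (hFc.sub hGc) hδ (fun a ha b hb hab => by
    have h1 := abs_le.1 (abs_arctan_le (abs_le.2 ha))
    have h2 := abs_le.1 (abs_arctan_le (abs_le.2 hb))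
    exact hmono (show θ + arctan a ∈ _ from ⟨by linarith, by linarith⟩)
      (show θ + arctan b ∈ _ from ⟨by linarith, by linarith⟩) (by gcongr))
  have he0 : e 0 = 0 := by rw [he 0 ⟨by linarith, hδ.le⟩]; simp [h0]
  have hU : IsOpen {x : ℝ × ℝ | |x.1| < δ} := isOpen_lt (by fun_prop) continuous_const
  have := crossAt_of_affineChart (directionEquiv θ)
    (straighten e hcc hFc (fun t => (cos_arctan_pos t).ne') 1) hU (x₀ := (0, f θ))
    (C := polarCurve f) (D := polarCurve g) (by simpa using hδ) (by simp [straighten, he0])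
    (fun x _ => by
      rw [affineChart_directionEquiv_symm, polar_mem_polarCurve hfa]
      simp [straighten, sub_eq_zero])
    (fun x hx => by
      rw [affineChart_directionEquiv_symm, polar_mem_polarCurve hga]
      have hx := abs_lt.1 (show |x.1| < δ from hx)
      simp only [straighten, Homeomorph.homeomorph_mk_coe, Equiv.coe_fn_mk,
        he _ ⟨hx.1.le, hx.2.le⟩, Pi.sub_apply]
      constructor <;> intro h <;> linarith)
  rwa [affineChart_directionEquiv_symm, arctan_zero, cos_zero, add_zero, mul_one] at this

theorem crossAt_polarCurve_radialLine {f : ℝ → ℝ} (hf : Continuous f)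
    (hfa : Function.Antiperiodic f π) (θ : ℝ) :
    CrossAt (polarCurve f) (radialLine θ) (polar θ (f θ)) := by
  have hFc : Continuous fun t => f (θ + arctan t) := by fun_prop
  have hcc : Continuous fun t => cos (arctan t) := by fun_prop
  have := crossAt_of_affineChart (directionEquiv θ)
    -- With ε = 0 the first coordinate is kept, and the radial line is already the vertical axis.
    (straighten (Homeomorph.refl ℝ) hcc hFc (fun t => (cos_arctan_pos t).ne') 0) isOpen_univ
    (x₀ := (0, f θ)) (C := polarCurve f) (D := radialLine θ) (mem_univ _) (by simp [straighten])
    (fun x _ => by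
      rw [affineChart_directionEquiv_symm, polar_mem_polarCurve hfa]
      simp [straighten, sub_eq_zero])
    (fun x _ => by
      rw [affineChart_directionEquiv_symm, polar_mem_radialLine]
      have h1 := arctan_lt_pi_div_two x.1
      have h2 := neg_pi_div_two_lt_arctan x.1
      simp only [straighten, Homeomorph.homeomorph_mk_coe, Equiv.coe_fn_mk, zero_mul, zero_add,
        Homeomorph.refl_apply, id]
      constructor
      · rintro ⟨n, hn⟩
        have hn : arctan x.1 = n * π := by linarith
        have hn0 : n = 0 := by
          have hp := pi_pos
          have a1 : (n : ℝ) < 1 := by nlinarith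
          have a2 : (-1 : ℝ) < n := by nlinarith
          have a1 : n < 1 := by exact_mod_cast a1
          have a2 : -1 < n := by exact_mod_cast a2
          omega
        rw [hn0] at hn
        simpa using hn
      · intro h
        exact ⟨0, by simp [h]⟩)
  rwa [affineChart_directionEquiv_symm, arctan_zero, cos_zero, add_zero, mul_one] at this

/-- The linear equivalence underlying the affine chart around the origin in which two given
directions are the coordinate axes. -/
noncomputable def originEquiv (α β : ℝ) (h : sin (β - α) ≠ 0) :
    (Fin 3 → ℝ) ≃ₗ[ℝ] (Fin 3 → ℝ) where
  toFun v := ![cos β * v 1 - sin β * v 0, cos α * v 1 - sin α * v 0, v 2]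
  invFun w := ![(cos β * w 1 - cos α * w 0) / sin (β - α),
    (sin β * w 1 - sin α * w 0) / sin (β - α), w 2]
  map_add' v w := by ext i; fin_cases i <;> simp <;> ring
  map_smul' a v := by ext i; fin_cases i <;> simp <;> ring
  left_inv v := by
    ext i
    fin_cases i <;> simp <;> field_simp <;> rw [sin_sub] <;> ring
  right_inv v := by
    ext i
    fin_cases i <;> simp <;> field_simp <;> rw [sin_sub] <;> ring

theorem crossAt_radialLine {α β : ℝ} (h : sin (β - α) ≠ 0) :
    CrossAt (radialLine α) (radialLine β) origin := by
  have h0 : (affineChart (originEquiv α β h)).symm (0, 0) = origin := by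
    refine (Projectivization.mk_eq_mk_iff' ..).2 ⟨1, ?_⟩
    ext i
    fin_cases i <;> simp [originEquiv]
  rw [← h0]
  refine crossAt_of_affineChart _ (Homeomorph.refl _) isOpen_univ (mem_univ _) rfl
    (fun x _ => ?_) (fun x _ => ?_)
  · have : (affineChart (originEquiv α β h)).symm x ∈ radialLine α ↔ _ := mk_mem_radialLine _
    rw [this]
    have := congrFun ((originEquiv α β h).apply_symm_apply ![x.1, x.2, 1]) 1
    have : cos α * (originEquiv α β h).symm ![x.1, x.2, 1] 1 -
        sin α * (originEquiv α β h).symm ![x.1, x.2, 1] 0 = x.2 := this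
    change _ ↔ x.2 = 0
    constructor <;> intro h <;> linarith
  · have : (affineChart (originEquiv α β h)).symm x ∈ radialLine β ↔ _ := mk_mem_radialLine _
    rw [this]
    have := congrFun ((originEquiv α β h).apply_symm_apply ![x.1, x.2, 1]) 0
    have : cos β * (originEquiv α β h).symm ![x.1, x.2, 1] 1 -
        sin β * (originEquiv α β h).symm ![x.1, x.2, 1] 0 = x.1 := this
    change _ ↔ x.1 = 0
    constructor <;> intro h <;> linarith

/-! ### The triangle wave -/

/-- The triangle wave of slope `±1` with maximum `π / 2` at `0`. -/
noncomputable def tri (x : ℝ) : ℝ := arcsin (cos x)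

theorem continuous_tri : Continuous tri := continuous_arcsin.comp continuous_cos

theorem tri_antiperiodic : Function.Antiperiodic tri π := fun x => by
  rw [tri, cos_add_pi, arcsin_neg, tri]

theorem tri_neg (x : ℝ) : tri (-x) = tri x := by rw [tri, cos_neg, tri]

theorem tri_sub_int_mul (x : ℝ) (n : ℤ) : tri (x - n * (2 * π)) = tri x := by
  rw [tri, cos_sub_int_mul_two_pi, tri]

theorem tri_of_abs_le {x : ℝ} (h : |x| ≤ π) : tri x = π / 2 - |x| := by
  rw [tri, ← cos_abs, arcsin_eq_pi_div_two_sub_arccos, arccos_cos (abs_nonneg x) h]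

theorem exists_tri_eq (x : ℝ) :
    ∃ n : ℤ, |x - n * (2 * π)| ≤ π ∧ tri x = π / 2 - |x - n * (2 * π)| := by
  have h : |x - round (x / (2 * π)) * (2 * π)| ≤ π := by
    have hp := two_pi_pos
    have := abs_sub_round (x / (2 * π))
    have e : x - round (x / (2 * π)) * (2 * π) = (x / (2 * π) - round (x / (2 * π))) * (2 * π) := by
      field_simp
    rw [e, abs_mul, abs_of_pos hp]
    nlinarith
  exact ⟨_, h, by rw [← tri_of_abs_le h, tri_sub_int_mul]⟩

/-- `tri` is the upper envelope of tents of slope ±1 centred at the multiples of 2π; this yields the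
Lipschitz bound. -/
theorem pi_div_two_sub_abs_le_tri (x : ℝ) (n : ℤ) : π / 2 - |x - n * (2 * π)| ≤ tri x := by
  rw [← tri_sub_int_mul x n]
  rcases le_total |x - n * (2 * π)| π with h | h
  · exact (tri_of_abs_le h).ge
  · have : -(π / 2) ≤ tri (x - n * (2 * π)) := neg_pi_div_two_le_arcsin _
    linarith

theorem abs_tri_sub_le (x y : ℝ) : |tri x - tri y| ≤ |x - y| := by
  have key : ∀ x y, tri x - tri y ≤ |x - y| := fun x y => by
    obtain ⟨n, -, hn⟩ := exists_tri_eq x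
    have h1 := pi_div_two_sub_abs_le_tri y n
    have h2 : |y - n * (2 * π)| ≤ |x - n * (2 * π)| + |x - y| := by
      rw [abs_sub_comm x y]
      have := abs_add_le (x - n * (2 * π)) (y - x)
      rwa [show x - n * (2 * π) + (y - x) = y - n * (2 * π) by ring] at this
    linarith
  rw [abs_le]
  have := key y x
  rw [abs_sub_comm] at this
  exact ⟨by linarith, key x y⟩

theorem tri_eq_tri_iff {x y : ℝ} :
    tri x = tri y ↔ ∃ k : ℤ, y = 2 * k * π + x ∨ y = 2 * k * π - x := by
  rw [← cos_eq_cos_iff]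
  constructor
  · exact fun h => injOn_arcsin ⟨neg_one_le_cos x, cos_le_one x⟩ ⟨neg_one_le_cos y, cos_le_one y⟩ h
  · intro h
    rw [tri, h, tri]

/-! ### Wave curves -/

/-- A triangle wave of amplitude `a * π / 2` centred at `c`. -/
noncomputable def wave (a c φ : ℝ) : ℝ := a * tri (φ - c)

theorem continuous_wave (a c : ℝ) : Continuous (wave a c) :=
  continuous_const.mul (continuous_tri.comp (continuous_id.sub continuous_const))

theorem wave_antiperiodic (a c : ℝ) : Function.Antiperiodic (wave a c) π := fun φ => by
  rw [wave, wave, show φ + π - c = φ - c + π by ring, tri_antiperiodic, mul_neg]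

/-- Two curves meet in exactly one point, and cross there. -/
def CrossOnce (C D : Set RealProjectivePlane) : Prop := ∃ p, C ∩ D = {p} ∧ CrossAt C D p

theorem CrossOnce.symm {C D : Set RealProjectivePlane} (h : CrossOnce C D) : CrossOnce D C := by
  obtain ⟨p, hp, hc⟩ := h
  exact ⟨p, by rw [inter_comm, hp], crossAt_symm hc⟩

theorem polarCurve_inter_polarCurve {f g : ℝ → ℝ} (hfa : Function.Antiperiodic f π)
    (hga : Function.Antiperiodic g π) {θ : ℝ} (h0 : f θ = g θ)
    (huniq : ∀ φ, f φ = g φ → ∃ n : ℤ, φ = θ + n * π) :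
    polarCurve f ∩ polarCurve g = {polar θ (f θ)} := by
  ext p
  simp only [mem_inter_iff, mem_singleton_iff]
  constructor
  · rintro ⟨⟨φ, rfl⟩, h⟩
    obtain ⟨n, rfl⟩ := huniq φ ((polar_mem_polarCurve hga _ _).1 h)
    exact (polar_apply_periodic hfa).int_mul n θ
  · rintro rfl
    exact ⟨(polar_mem_polarCurve hfa _ _).2 rfl, (polar_mem_polarCurve hga _ _).2 h0⟩

theorem crossOnce_polarCurve {f g : ℝ → ℝ} (hf : Continuous f) (hg : Continuous g)
    (hfa : Function.Antiperiodic f π) (hga : Function.Antiperiodic g π) {θ δ : ℝ} (hδ : 0 < δ)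
    (h0 : f θ = g θ) (hmono : StrictMonoOn (fun φ => f φ - g φ) (Icc (θ - δ) (θ + δ)))
    (huniq : ∀ φ, f φ = g φ → ∃ n : ℤ, φ = θ + n * π) :
    CrossOnce (polarCurve f) (polarCurve g) :=
  ⟨_, polarCurve_inter_polarCurve hfa hga h0 huniq, crossAt_polarCurve hf hg hfa hga hδ h0 hmono⟩

theorem crossOnce_polarCurve_radialLine {f : ℝ → ℝ} (hf : Continuous f)
    (hfa : Function.Antiperiodic f π) (θ : ℝ) : CrossOnce (polarCurve f) (radialLine θ) := by
  refine ⟨_, ?_, crossAt_polarCurve_radialLine hf hfa θ⟩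
  ext p
  simp only [mem_inter_iff, mem_singleton_iff]
  constructor
  · rintro ⟨⟨φ, rfl⟩, h⟩
    obtain ⟨n, rfl⟩ := polar_mem_radialLine.1 h
    exact (polar_apply_periodic hfa).int_mul n θ
  · rintro rfl
    exact ⟨⟨θ, rfl⟩, polar_mem_radialLine.2 ⟨0, by simp⟩⟩

theorem radialLine_inter_radialLine {α β : ℝ} (h : sin (β - α) ≠ 0) :
    radialLine α ∩ radialLine β = {origin} := by
  ext p
  simp only [mem_inter_iff, mem_singleton_iff]
  constructor
  · rintro ⟨hα, hβ⟩
    obtain rfl | ⟨φ, s, rfl⟩ := eq_origin_or_exists_polar p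
    · rfl
    · obtain ⟨n, hn⟩ := polar_mem_radialLine.1 hα
      obtain ⟨m, hm⟩ := polar_mem_radialLine.1 hβ
      refine absurd (sin_eq_zero_iff.2 ⟨n - m, ?_⟩) h
      push_cast
      linarith
  · rintro rfl
    exact ⟨origin_mem_radialLine _, origin_mem_radialLine _⟩

theorem crossOnce_radialLine {α β : ℝ} (h : sin (β - α) ≠ 0) :
    CrossOnce (radialLine α) (radialLine β) :=
  ⟨_, radialLine_inter_radialLine h, crossAt_radialLine h⟩

/-- Waves of different amplitudes cross exactly once. -/
theorem crossOnce_wave_of_lt {a a' : ℝ} (ha' : 0 ≤ a') (h : a' < a) (c c' : ℝ) :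
    CrossOnce (polarCurve (wave a c)) (polarCurve (wave a' c')) := by
  have hp := pi_pos
  have hA := wave_antiperiodic a c
  have hA' := wave_antiperiodic a' c'
  let g : ℝ → ℝ := fun φ => wave a' c' φ - wave a c φ
  have hgc : Continuous g := (continuous_wave a' c').sub (continuous_wave a c)
  -- On this half-period the steeper wave falls at rate exactly `a`, while the other changes at rate
  -- at most `a'`.
  have hmono : StrictMonoOn g (Icc c (c + π)) := by
    intro x hx y hy hxy
    have h1 : tri (x - c) = π / 2 - (x - c) := by
      rw [tri_of_abs_le] <;> rw [abs_of_nonneg (by linarith [hx.1])]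
      linarith [hx.2]
    have h2 : tri (y - c) = π / 2 - (y - c) := by
      rw [tri_of_abs_le] <;> rw [abs_of_nonneg (by linarith [hy.1])]
      linarith [hy.2]
    have h3 := (abs_le.1 (abs_tri_sub_le (y - c') (x - c'))).1
    rw [abs_of_nonneg (by linarith)] at h3
    simp only [g, wave, h1, h2]
    nlinarith
  -- The steeper wave is strictly above at its peak; antiperiodicity reverses the sign at `c + π`.
  have hgc0 : g c < 0 := by
    have h1 : tri (c - c) = π / 2 := by rw [sub_self, tri_of_abs_le] <;> simp [hp.le]
    have h2 : tri (c - c') ≤ π / 2 := arcsin_le_pi_div_two _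
    simp only [g, wave, h1]
    nlinarith
  have hganti : ∀ x, g (x + π) = - g x := fun x => by
    simp only [g, hA x, hA' x]; ring
  have hper : ∀ x, g x = 0 → ∀ n : ℤ, g (x + n * π) = 0 := fun x hx n => by
    have := Function.Antiperiodic.add_int_mul_eq hganti n (x := x)
    rw [this, hx]; simp
  obtain ⟨θ, hθ, hθ0⟩ : (0 : ℝ) ∈ g '' Ioo c (c + π) :=
    intermediate_value_Ioo (by linarith) hgc.continuousOn ⟨hgc0, by rw [hganti]; linarith⟩
  have hδ : 0 < min (θ - c) (c + π - θ) := lt_min (by linarith [hθ.1]) (by linarith [hθ.2])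
  have hδ1 := min_le_left (θ - c) (c + π - θ)
  have hδ2 := min_le_right (θ - c) (c + π - θ)
  refine (crossOnce_polarCurve (continuous_wave a' c') (continuous_wave a c) hA' hA hδ
    (sub_eq_zero.1 hθ0) (hmono.mono (Icc_subset_Icc (by linarith) (by linarith)))
    fun φ hφ => ?_).symm
  obtain ⟨n, hn, -⟩ := existsUnique_sub_zsmul_mem_Ico hp φ c
  simp only [zsmul_eq_mul] at hn
  have h1 : g (φ - n * π) = 0 := by
    have := hper φ (sub_eq_zero.2 hφ) (-n)
    rwa [Int.cast_neg, neg_mul, ← sub_eq_add_neg] at this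
  have := hmono.injOn ⟨hn.1, hn.2.le⟩ ⟨hθ.1.le, hθ.2.le⟩ (h1.trans hθ0.symm)
  exact ⟨n, by linarith⟩

/-- Waves of the same amplitude and different centres cross exactly once. -/
theorem crossOnce_wave_of_ne {a : ℝ} (ha : 0 < a) {c c' : ℝ}
    (h : ∀ k : ℤ, c' - c ≠ k * (2 * π)) :
    CrossOnce (polarCurve (wave a c)) (polarCurve (wave a c')) := by
  have hp := pi_pos
  have huniq : ∀ φ, wave a c φ = wave a c' φ → ∃ n : ℤ, φ = (c + c') / 2 + n * π := by
    intro φ hφ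
    obtain ⟨k, hk | hk⟩ := tri_eq_tri_iff.1 (mul_left_cancel₀ ha.ne' hφ)
    · refine absurd ?_ (h (-k))
      push_cast
      linarith
    · exact ⟨k, by linarith⟩
  have hval : ∀ t, wave a c ((c + c') / 2 + t) - wave a c' ((c + c') / 2 + t) =
      a * (tri ((c' - c) / 2 + t) - tri ((c' - c) / 2 - t)) := fun t => by
    rw [wave, wave, ← tri_neg ((c' - c) / 2 - t), mul_sub]
    congr 3 <;> ring
  obtain ⟨n, hn, -⟩ := exists_tri_eq ((c' - c) / 2)
  -- Half the distance between the centres, reduced modulo 2π. Distinct centres exclude 0 and ±π, so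
  -- near the midpoint each wave stays on one slope, and the two slopes are opposite.
  set w := (c' - c) / 2 - n * (2 * π) with hw
  have hval' : ∀ t, |w + t| ≤ π → |w - t| ≤ π →
      wave a c ((c + c') / 2 + t) - wave a c' ((c + c') / 2 + t) =
        a * (|w - t| - |w + t|) := fun t h1 h2 => by
    rw [hval, ← tri_sub_int_mul ((c' - c) / 2 + t) n, ← tri_sub_int_mul ((c' - c) / 2 - t) n,
      show (c' - c) / 2 + t - n * (2 * π) = w + t by rw [hw]; ring,
      show (c' - c) / 2 - t - n * (2 * π) = w - t by rw [hw]; ring,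
      tri_of_abs_le h1, tri_of_abs_le h2]
    ring
  have h0 : wave a c ((c + c') / 2) = wave a c' ((c + c') / 2) := by
    have := hval' 0 (by simpa using hn) (by simpa using hn)
    simpa [sub_eq_zero] using this
  have hw0 : w ≠ 0 := fun h0 => h (2 * n) (by push_cast; linarith)
  have hwp : w ≠ π := fun h0 => h (2 * n + 1) (by push_cast; linarith)
  have hwn : w ≠ -π := fun h0 => h (2 * n - 1) (by push_cast; linarith)
  have hw2 : |w| ≠ π := fun h1 => by
    rcases abs_eq hp.le |>.1 h1 with h | h
    · exact hwp h
    · exact hwn h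
  have hwlt : |w| < π := lt_of_le_of_ne hn hw2
  have hδ : 0 < min |w| (π - |w|) := lt_min (abs_pos.2 hw0) (by linarith)
  have hδ1 := min_le_left |w| (π - |w|)
  have hδ2 := min_le_right |w| (π - |w|)
  have hA := wave_antiperiodic a c
  have hA' := wave_antiperiodic a c'
  have hbd : ∀ t, |t| ≤ min |w| (π - |w|) → |w + t| ≤ π ∧ |w - t| ≤ π := fun t ht =>
    ⟨(abs_add_le _ _).trans (by linarith), (abs_sub _ _).trans (by linarith)⟩
  rcases hw0.lt_or_gt with hneg | hpos
  · refine crossOnce_polarCurve (continuous_wave a c) (continuous_wave a c') hA hA' hδ h0 ?_ huniq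
    rw [abs_of_neg hneg] at hδ1 hbd hδ hδ2 ⊢
    have hlin : ∀ x ∈ Icc ((c + c') / 2 - min (-w) (π - -w)) ((c + c') / 2 + min (-w) (π - -w)),
        wave a c x - wave a c' x = a * (2 * (x - (c + c') / 2)) := by
      intro x hx
      have hx' : |x - (c + c') / 2| ≤ min (-w) (π - -w) :=
        abs_le.2 ⟨by linarith [hx.1], by linarith [hx.2]⟩
      obtain ⟨b1, b2⟩ := hbd _ hx'
      have := hval' _ b1 b2
      rw [add_sub_cancel] at this
      have hx' := abs_le.1 hx'
      rw [this, abs_of_nonpos (show w - (x - (c + c') / 2) ≤ 0 by linarith),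
        abs_of_nonpos (show w + (x - (c + c') / 2) ≤ 0 by linarith)]
      ring
    intro x hx y hy hxy
    change wave a c x - wave a c' x < wave a c y - wave a c' y
    rw [hlin x hx, hlin y hy]
    nlinarith
  · refine (crossOnce_polarCurve (continuous_wave a c') (continuous_wave a c) hA' hA hδ
      (δ := min |w| (π - |w|)) h0.symm ?_ fun φ hφ => huniq φ hφ.symm).symm
    rw [abs_of_pos hpos] at hδ1 hbd hδ hδ2 ⊢
    have hlin : ∀ x ∈ Icc ((c + c') / 2 - min w (π - w)) ((c + c') / 2 + min w (π - w)),
        wave a c x - wave a c' x = a * (-2 * (x - (c + c') / 2)) := by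
      intro x hx
      have hx' : |x - (c + c') / 2| ≤ min w (π - w) :=
        abs_le.2 ⟨by linarith [hx.1], by linarith [hx.2]⟩
      obtain ⟨b1, b2⟩ := hbd _ hx'
      have := hval' _ b1 b2
      rw [add_sub_cancel] at this
      have hx' := abs_le.1 hx'
      rw [this, abs_of_nonneg (show 0 ≤ w - (x - (c + c') / 2) by linarith),
        abs_of_nonneg (show 0 ≤ w + (x - (c + c') / 2) by linarith)]
      ring
    intro x hx y hy hxy
    have h1 := hlin x hx
    have h2 := hlin y hy
    change wave a c' x - wave a c x < wave a c' y - wave a c y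
    nlinarith

/-! ### The arrangement -/

theorem not_isSimpleClosedCurve_singleton {X : Type*} [TopologicalSpace X] (p : X) :
    ¬ IsSimpleClosedCurve ({p} : Set X) := by
  rintro ⟨γ, -, hinj, hr⟩
  have hp : ∀ z, γ z = p := fun z => by
    have : γ z ∈ range γ := ⟨z, rfl⟩
    rwa [hr] at this
  have h : (1 : Circle) = -1 := hinj ((hp _).trans (hp _).symm)
  have h2 := congrArg (fun z : Circle => (z : ℂ).re) h
  norm_num at h2

section Family

variable {ι : Type*} {line : ι → Set RealProjectivePlane}

/-- Equal members would intersect in a whole curve, which is not a single point. Counting members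
thus becomes counting indices. -/
theorem injective_of_crossOnce (hs : ∀ i, IsSimpleClosedCurve (line i))
    (hc : Pairwise fun i i' => CrossOnce (line i) (line i')) : Function.Injective line := by
  intro i i' h
  by_contra hne
  obtain ⟨p, hp, -⟩ := hc hne
  rw [h, inter_self] at hp
  exact not_isSimpleClosedCurve_singleton p (hp ▸ hs i')

open Classical in
theorem isPseudolineArrangement_image [Fintype ι] (hs : ∀ i, IsSimpleClosedCurve (line i))
    (hc : Pairwise fun i i' => CrossOnce (line i) (line i')) :
    IsPseudolineArrangement (Finset.univ.image line) := by
  refine ⟨by simpa using hs, ?_⟩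
  simp only [Finset.mem_image, Finset.mem_univ, true_and]
  rintro _ ⟨i, rfl⟩ _ ⟨i', rfl⟩ hne
  exact hc fun h => hne (h ▸ rfl)

open Classical in
theorem vertexCount_image_le [Fintype ι] {i : ι} (S : Finset RealProjectivePlane)
    (hS : ∀ i' ≠ i, line i ∩ line i' ⊆ S) :
    vertexCount (Finset.univ.image line) (line i) ≤ S.card := by
  rw [vertexCount, ← ncard_coe_finset]
  refine ncard_le_ncard ?_ S.finite_toSet
  rintro p ⟨⟨C, hC, D, hD, hCD, hpC, hpD⟩, hp⟩
  obtain ⟨a, -, rfl⟩ := Finset.mem_image.1 hC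
  obtain ⟨b, -, rfl⟩ := Finset.mem_image.1 hD
  by_cases ha : a = i
  · subst ha
    exact hS b (fun h => hCD (h ▸ rfl)) ⟨hp, hpD⟩
  · exact hS a ha ⟨hp, hpC⟩

end Family

/-- The angular unit: `2κ` steps make up the angle `π`. -/
noncomputable def step (κ : ℕ) : ℝ := π / (2 * κ)

theorem step_pos {κ : ℕ} (hκ : 0 < κ) : 0 < step κ := by
  have : (0 : ℝ) < κ := by exact_mod_cast hκ
  have := pi_pos
  unfold step; positivity

theorem pi_eq_step_mul {κ : ℕ} (hκ : 0 < κ) : π = step κ * (2 * κ) := by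
  have : (0 : ℝ) < κ := by exact_mod_cast hκ
  unfold step; field_simp

/-- The amplitude of the two families of waves. -/
def amplitude (b : Bool) : ℝ := bif b then 3 else 1

/-- The members of the arrangement: `2κ` lines through the origin, two families of `2κ` waves
and the line at infinity. -/
noncomputable def member (κ : ℕ) : Fin (2 * κ) ⊕ Option (Bool × Fin (2 * κ)) →
    Set RealProjectivePlane
  | .inl m => radialLine (step κ * (m : ℕ))
  | .inr none => polarCurve (wave 0 0)
  | .inr (some (b, i)) => polarCurve (wave (amplitude b) (step κ * (2 * (i : ℕ))))

theorem isSimpleClosedCurve_member (κ : ℕ) (l) : IsSimpleClosedCurve (member κ l) := by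
  rcases l with m | _ | ⟨b, i⟩
  · exact isSimpleClosedCurve_radialLine _
  · exact isSimpleClosedCurve_polarCurve (continuous_wave _ _) (wave_antiperiodic _ _)
  · exact isSimpleClosedCurve_polarCurve (continuous_wave _ _) (wave_antiperiodic _ _)

theorem amplitude_pos (b : Bool) : 0 < amplitude b := by cases b <;> simp [amplitude]

theorem fin_eq_of_sub_eq {n : ℕ} {i i' : Fin n} {k : ℤ}
    (h : ((i' : ℕ) : ℝ) - (i : ℕ) = k * n) : i = i' := by
  have h1 : ((i' : ℕ) : ℤ) - (i : ℕ) = k * n := by exact_mod_cast h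
  have := i.2
  have := i'.2
  have hk : k = 0 := by
    by_contra hk
    rcases lt_or_gt_of_ne hk with h | h
    · nlinarith
    · nlinarith
  subst hk
  ext
  omega

theorem crossOnce_member {κ : ℕ} (hκ : 0 < κ) :
    Pairwise fun l l' => CrossOnce (member κ l) (member κ l') := by
  have hs := step_pos hκ
  have hπ := pi_eq_step_mul hκ
  intro l l' hne
  rcases l with m | _ | ⟨b, i⟩ <;> rcases l' with m' | _ | ⟨b', i'⟩
  · refine crossOnce_radialLine fun h => hne ?_
    obtain ⟨k, hk⟩ := sin_eq_zero_iff.1 h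
    refine congrArg _ (fin_eq_of_sub_eq (k := k) (mul_left_cancel₀ hs.ne' ?_))
    rw [hπ] at hk
    push_cast
    linarith
  · exact (crossOnce_polarCurve_radialLine (continuous_wave _ _) (wave_antiperiodic _ _) _).symm
  · exact (crossOnce_polarCurve_radialLine (continuous_wave _ _) (wave_antiperiodic _ _) _).symm
  · exact crossOnce_polarCurve_radialLine (continuous_wave _ _) (wave_antiperiodic _ _) _
  · exact absurd rfl hne
  · exact (crossOnce_wave_of_lt le_rfl (amplitude_pos b') _ _).symm
  · exact crossOnce_polarCurve_radialLine (continuous_wave _ _) (wave_antiperiodic _ _) _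
  · exact crossOnce_wave_of_lt le_rfl (amplitude_pos b) _ _
  · by_cases hb : b = b'
    · subst hb
      refine crossOnce_wave_of_ne (amplitude_pos b) fun k hk => hne ?_
      suffices i = i' by rw [this]
      refine fin_eq_of_sub_eq (k := k) (mul_left_cancel₀ hs.ne' ?_)
      rw [hπ] at hk
      push_cast
      linarith
    · have h13 : amplitude false < amplitude true := by norm_num [amplitude]
      cases b <;> cases b' <;> simp only [not_true, reduceCtorEq] at hb
      · exact (crossOnce_wave_of_lt (amplitude_pos _).le h13 _ _).symm
      · exact crossOnce_wave_of_lt (amplitude_pos _).le h13 _ _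

/-! ### Vertices -/

theorem exists_tri_step_eq {κ : ℕ} (hκ : 0 < κ) (x : ℝ) :
    ∃ n : ℤ, |x - n * (4 * κ)| ≤ 2 * κ ∧ tri (step κ * x) = step κ * (κ - |x - n * (4 * κ)|) := by
  have hs := step_pos hκ
  have hπ := pi_eq_step_mul hκ
  obtain ⟨n, h1, h2⟩ := exists_tri_eq (step κ * x)
  have e : step κ * x - n * (2 * π) = step κ * (x - n * (4 * κ)) := by
    rw [hπ]; ring
  rw [e, abs_mul, abs_of_pos hs] at h1 h2
  refine ⟨n, ?_, ?_⟩
  · rw [hπ] at h1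
    exact le_of_mul_le_mul_left h1 hs
  · rw [h2, hπ]; ring

/-- The triangle wave vanishes at integral multiples of the angular unit only. -/
theorem exists_int_of_tri_eq_zero {κ : ℕ} (hκ : 0 < κ) {x : ℝ} (h : tri (step κ * x) = 0) :
    ∃ z : ℤ, x = z := by
  obtain ⟨n, -, hn⟩ := exists_tri_step_eq hκ x
  rw [h, eq_comm, mul_eq_zero, or_iff_right (step_pos hκ).ne', sub_eq_zero, eq_comm] at hn
  rcases abs_eq (by positivity) |>.1 hn with h | h
  · exact ⟨n * (4 * κ) + κ, by push_cast; linarith⟩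
  · exact ⟨n * (4 * κ) - κ, by push_cast; linarith⟩

/-- The waves agree midway between their centres, modulo 2κ. The centres are even so that this
midpoint is integral. -/
theorem exists_int_of_tri_eq_tri {κ : ℕ} (hκ : 0 < κ) {x : ℝ} {i i' : ℤ}
    (hne : ∀ k : ℤ, i' - i ≠ k * (2 * κ))
    (h : tri (step κ * (x - 2 * i)) = tri (step κ * (x - 2 * i'))) : ∃ z : ℤ, x = z := by
  have hs := step_pos hκ
  have hπ := pi_eq_step_mul hκ
  obtain ⟨k, hk | hk⟩ := tri_eq_tri_iff.1 h
  · refine absurd ?_ (hne (-k))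
    rw [hπ] at hk
    have : x - 2 * i' = 2 * k * (2 * κ) + (x - 2 * i) :=
      mul_left_cancel₀ hs.ne' (hk.trans (by ring))
    have : (i' - i : ℝ) = -k * (2 * κ) := by linarith
    exact_mod_cast this
  · refine ⟨k * (2 * κ) + i + i', ?_⟩
    rw [hπ] at hk
    have : x - 2 * i' = 2 * k * (2 * κ) - (x - 2 * i) :=
      mul_left_cancel₀ hs.ne' (hk.trans (by ring))
    push_cast
    linarith

/-- The crossing of waves of amplitudes `3` and `1` is at an integral multiple of the angular
unit, or at one of few half-integral multiples. -/
theorem exists_of_three_mul_tri_eq {j : ℕ} {x : ℝ} {i i' : ℤ}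
    (h : 3 * tri (step (3 * j + 1) * (x - 2 * i)) = tri (step (3 * j + 1) * (x - 2 * i'))) :
    (∃ z : ℤ, x = z) ∨
    (∃ t ∈ Finset.Ico (-j : ℤ) j, ∃ m : ℤ,
        x = 2 * i + (3 * j + 1) + (t + 1 / 2) + m * (2 * (3 * j + 1))) ∧
    (∃ t ∈ Finset.Ico (-j : ℤ) j, ∃ m : ℤ,
        x = 2 * i' + (3 * j + 1) + 3 * (t + 1 / 2) + m * (2 * (3 * j + 1))) := by
  have hκ : 0 < 3 * j + 1 := by omega
  have hs := step_pos hκ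
  obtain ⟨n, h1, h2⟩ := exists_tri_step_eq hκ (x - 2 * i)
  obtain ⟨n', h3, h4⟩ := exists_tri_step_eq hκ (x - 2 * i')
  rw [h2, h4] at h
  replace h : 3 * (((3 * j + 1 : ℕ) : ℝ) - |x - 2 * i - n * (4 * (3 * j + 1 : ℕ))|) =
      ((3 * j + 1 : ℕ) : ℝ) - |x - 2 * i' - n' * (4 * (3 * j + 1 : ℕ))| :=
    mul_left_cancel₀ hs.ne' (by linarith)
  clear h2 h4 hs hκ
  push_cast at h h1 h3
  set y := x - 2 * i - n * (4 * (3 * j + 1)) with hy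
  set z := x - 2 * i' - n' * (4 * (3 * j + 1)) with hz
  obtain ⟨d, hd⟩ : ∃ d : ℤ, d = i' - i + (n' - n) * (2 * (3 * j + 1)) := ⟨_, rfl⟩
  have hdr : (d : ℝ) = i' - i + (n' - n) * (2 * (3 * j + 1)) := by rw [hd]; push_cast; ring
  have hzy : z = y - 2 * d := by rw [hz, hy, hdr]; ring
  have hyx : x = y + 2 * i + n * (4 * (3 * j + 1)) := by rw [hy]; ring
  have hzx : x = z + 2 * i' + n' * (4 * (3 * j + 1)) := by rw [hz]; ring
  clear_value y z
  rcases le_total 0 y with y0 | y0 <;> rcases le_total 0 z with z0 | z0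
  -- Slopes of the same sign: the equation reduces to y = κ - d, an integer.
  · rw [abs_of_nonneg y0, abs_of_nonneg z0] at *
    left
    refine ⟨(3 * j + 1) - d + 2 * i + n * (4 * (3 * j + 1)), ?_⟩
    push_cast
    linarith
  · rw [abs_of_nonneg y0, abs_of_nonpos z0] at *
    have hy2 : 2 * y = (3 * j + 1) + d := by linarith
    -- The bounds -2κ ≤ z ≤ 0 say |y - κ| ≤ κ/3 = j + 1/3, so a half-integral y is κ + t + 1/2 with
    -- -j ≤ t < j.
    have e1 : ((3 * j + 1 : ℤ) : ℝ) ≤ (3 * d : ℤ) := by push_cast; linarith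
    have e2 : ((3 * d : ℤ) : ℝ) ≤ (5 * (3 * j + 1) : ℤ) := by push_cast; linarith
    rw [Int.cast_le] at e1 e2
    rcases Int.even_or_odd' (3 * j + 1 + d) with ⟨q, hq | hq⟩
    · left
      have hqr : (3 * j + 1 + d : ℝ) = 2 * q := by exact_mod_cast hq
      refine ⟨q + 2 * i + n * (4 * (3 * j + 1)), ?_⟩
      push_cast
      linarith
    · right
      have hqr : (3 * j + 1 + d : ℝ) = 2 * q + 1 := by exact_mod_cast hq
      constructor
      · refine ⟨q - (3 * j + 1), ?_, n * 2, ?_⟩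
        · rw [Finset.mem_Ico]; omega
        · push_cast; linarith
      -- The shallow wave is three times as far from its zero, on the opposite side, so t becomes -t
      -- - 1. That zero is at -κ rather than κ, which accounts for the -1 in the period.
      · refine ⟨3 * j + 1 - q - 1, ?_, n' * 2 - 1, ?_⟩
        · rw [Finset.mem_Ico]; omega
        · push_cast; linarith
  · rw [abs_of_nonpos y0, abs_of_nonneg z0] at *
    have hy2 : 2 * y = -(3 * j + 1) + d := by linarith
    have e1 : ((3 * j + 1 : ℤ) : ℝ) ≤ (-3 * d : ℤ) := by push_cast; linarith
    have e2 : ((-3 * d : ℤ) : ℝ) ≤ (5 * (3 * j + 1) : ℤ) := by push_cast; linarith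
    rw [Int.cast_le] at e1 e2
    rcases Int.even_or_odd' (3 * j + 1 + d) with ⟨q, hq | hq⟩
    · left
      have hqr : (3 * j + 1 + d : ℝ) = 2 * q := by exact_mod_cast hq
      refine ⟨q - (3 * j + 1) + 2 * i + n * (4 * (3 * j + 1)), ?_⟩
      push_cast
      linarith
    · right
      have hqr : (3 * j + 1 + d : ℝ) = 2 * q + 1 := by exact_mod_cast hq
      constructor
      · refine ⟨q, ?_, n * 2 - 1, ?_⟩
        · rw [Finset.mem_Ico]; omega
        · push_cast; linarith
      · refine ⟨-q - 1, ?_, n' * 2, ?_⟩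
        · rw [Finset.mem_Ico]; omega
        · push_cast; linarith
  · rw [abs_of_nonpos y0, abs_of_nonpos z0] at *
    left
    refine ⟨-(3 * j + 1) - d + 2 * i + n * (4 * (3 * j + 1)), ?_⟩
    push_cast
    linarith

/-- Points of a curve with parameters that are integral, or half-integral from a short list. -/
theorem exists_finset_of_parameters {f : ℝ → ℝ} (hf : Function.Antiperiodic f π) (j : ℕ)
    (u ρ : ℝ) : ∃ S : Finset RealProjectivePlane, S.card ≤ 8 * j + 2 ∧
      ∀ x : ℝ, ((∃ z : ℤ, x = z) ∨ ∃ t ∈ Finset.Ico (-j : ℤ) j, ∃ m : ℤ,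
          x = u + ρ * (t + 1 / 2) + m * (2 * (3 * j + 1))) →
        polar (step (3 * j + 1) * x) (f (step (3 * j + 1) * x)) ∈ S := by
  classical
  have hπ := pi_eq_step_mul (κ := 3 * j + 1) (by omega)
  set γ : ℝ → RealProjectivePlane := fun x =>
    polar (step (3 * j + 1) * x) (f (step (3 * j + 1) * x)) with hγ
  have hper : ∀ (x : ℝ) (m : ℤ), γ (x + m * (2 * (3 * j + 1))) = γ x := fun x m => by
    have := (polar_apply_periodic hf).int_mul m (step (3 * j + 1) * x)
    have e : step (3 * j + 1) * (x + m * (2 * (3 * j + 1))) = step (3 * j + 1) * x + m * π := by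
      rw [hπ]; push_cast; ring
    simpa only [hγ, e] using this
  refine ⟨(Finset.Ico (0 : ℤ) (2 * (3 * j + 1))).image (fun z : ℤ => γ z) ∪
    (Finset.Ico (-j : ℤ) j).image fun t : ℤ => γ (u + ρ * (t + 1 / 2)), ?_, ?_⟩
  · refine (Finset.card_union_le _ _).trans ((add_le_add Finset.card_image_le
      Finset.card_image_le).trans ?_)
    simp only [Int.card_Ico]
    omega
  · rintro x (⟨z, rfl⟩ | ⟨t, ht, m, rfl⟩)
    · refine Finset.mem_union_left _ (Finset.mem_image.2 ⟨z % (2 * (3 * j + 1)), ?_, ?_⟩)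
      · rw [Finset.mem_Ico]
        exact ⟨Int.emod_nonneg _ (by omega), Int.emod_lt_of_pos _ (by omega)⟩
      · change _ = γ z
        rw [← hper _ (z / (2 * (3 * j + 1)))]
        congr 1
        have := Int.emod_add_mul_ediv z (2 * (3 * j + 1))
        nth_rw 3 [← this]
        push_cast
        ring
    · exact Finset.mem_union_right _ (Finset.mem_image.2 ⟨t, ht, (hper _ m).symm⟩)

theorem exists_eq_of_polar_mem_radialLine {κ : ℕ} (hκ : 0 < κ) {m : ℕ} {x s : ℝ}
    (h : polar (step κ * x) s ∈ radialLine (step κ * m)) : ∃ n : ℤ, x = m + n * (2 * κ) := by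
  obtain ⟨n, hn⟩ := polar_mem_radialLine.1 h
  refine ⟨n, mul_left_cancel₀ (step_pos hκ).ne' (hn.trans ?_)⟩
  rw [pi_eq_step_mul hκ]
  ring

theorem exists_eq_step_mul {κ : ℕ} (hκ : 0 < κ) (φ : ℝ) : ∃ x, φ = step κ * x :=
  ⟨φ / step κ, by rw [mul_div_cancel₀ _ (step_pos hκ).ne']⟩

theorem tri_eq_zero_of_wave_eq {κ : ℕ} {b : Bool} {c x : ℝ}
    (h : wave (amplitude b) (step κ * c) (step κ * x) = 0) : tri (step κ * (x - c)) = 0 := by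
  rw [wave, mul_eq_zero, or_iff_right (amplitude_pos b).ne', ← mul_sub] at h
  exact h

theorem wave_step (κ : ℕ) (a c x : ℝ) :
    wave a (step κ * c) (step κ * x) = a * tri (step κ * (x - c)) := by
  rw [wave, mul_sub]

/-! ### Vertex bounds for the individual members -/

open Classical in
theorem vertexCount_infinity_le (j : ℕ) :
    vertexCount (Finset.univ.image (member (3 * j + 1))) (member (3 * j + 1) (.inr none)) ≤
      8 * j + 2 := by
  have hκ : 0 < 3 * j + 1 := by omega
  -- The last two arguments are dummies: only integral parameters occur on the line at infinity.
  obtain ⟨S, hS, hmem⟩ := exists_finset_of_parameters (wave_antiperiodic 0 0) j 0 0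
  refine (vertexCount_image_le S fun l' hne => ?_).trans hS
  rintro _ ⟨⟨φ, rfl⟩, hp⟩
  obtain ⟨x, rfl⟩ := exists_eq_step_mul hκ φ
  refine hmem x (Or.inl ?_)
  rcases l' with m | _ | ⟨b, i⟩
  · obtain ⟨n, hn⟩ := exists_eq_of_polar_mem_radialLine hκ hp
    exact ⟨(m : ℕ) + n * (2 * (3 * j + 1)), by rw [hn]; push_cast; ring⟩
  · exact absurd rfl hne
  · have h := (polar_mem_polarCurve (wave_antiperiodic _ _) _ _).1 hp
    rw [wave, zero_mul, eq_comm] at h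
    obtain ⟨z, hz⟩ := exists_int_of_tri_eq_zero hκ (tri_eq_zero_of_wave_eq h)
    exact ⟨z + 2 * (i : ℕ), by push_cast; linarith⟩

open Classical in
theorem vertexCount_wave_le (j : ℕ) (b : Bool) (i : Fin (2 * (3 * j + 1))) :
    vertexCount (Finset.univ.image (member (3 * j + 1)))
      (member (3 * j + 1) (.inr (some (b, i)))) ≤ 8 * j + 2 := by
  have hκ : 0 < 3 * j + 1 := by omega
  -- The base point is a zero of the wave, κ units past its peak. Half-integral offsets from it are
  -- scaled by 1 on a steep wave and by 3 on a shallow one.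
  obtain ⟨S, hS, hmem⟩ := exists_finset_of_parameters
    (wave_antiperiodic (amplitude b) (step (3 * j + 1) * (2 * (i : ℕ)))) j
    (2 * (i : ℕ) + (3 * j + 1)) (bif b then 1 else 3)
  refine (vertexCount_image_le S fun l' hne => ?_).trans hS
  rintro _ ⟨⟨φ, rfl⟩, hp⟩
  obtain ⟨x, rfl⟩ := exists_eq_step_mul hκ φ
  refine hmem x ?_
  rcases l' with m | _ | ⟨b', i'⟩
  · obtain ⟨n, hn⟩ := exists_eq_of_polar_mem_radialLine hκ hp
    exact Or.inl ⟨(m : ℕ) + n * (2 * (3 * j + 1)), by rw [hn]; push_cast; ring⟩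
  · have h := (polar_mem_polarCurve (wave_antiperiodic _ _) _ _).1 hp
    rw [wave.eq_1 0, zero_mul] at h
    obtain ⟨z, hz⟩ := exists_int_of_tri_eq_zero hκ (tri_eq_zero_of_wave_eq h)
    exact Or.inl ⟨z + 2 * (i : ℕ), by push_cast; linarith⟩
  · have h := (polar_mem_polarCurve (wave_antiperiodic _ _) _ _).1 hp
    rw [wave_step, wave_step] at h
    have key := @exists_of_three_mul_tri_eq j x
    cases b <;> cases b' <;> simp only [amplitude, cond_true, cond_false, one_mul] at h ⊢
    · left
      refine exists_int_of_tri_eq_tri hκ (i := (i : ℕ)) (i' := (i' : ℕ)) (fun k hk => hne ?_)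
        (by push_cast; exact h)
      rw [fin_eq_of_sub_eq (i := i) (i' := i') (k := k) (by push_cast; exact_mod_cast hk)]
    · rcases key (i := (i' : ℕ)) (i' := (i : ℕ)) (by push_cast; exact h.symm) with h | ⟨-, h⟩
      · exact Or.inl h
      · exact Or.inr (by simpa using h)
    · rcases key (i := (i : ℕ)) (i' := (i' : ℕ)) (by push_cast; exact h) with h | ⟨h, -⟩
      · exact Or.inl h
      · exact Or.inr (by simpa using h)
    · left
      refine exists_int_of_tri_eq_tri hκ (i := (i : ℕ)) (i' := (i' : ℕ)) (fun k hk => hne ?_)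
        (by push_cast; linarith)
      rw [fin_eq_of_sub_eq (i := i) (i' := i') (k := k) (by push_cast; exact_mod_cast hk)]

/-- The possible heights of vertices on a line through the origin. -/
theorem exists_finset_heights {j : ℕ} (hj : 1 ≤ j) (m : ℕ) :
    ∃ S : Finset ℤ, S.card ≤ 8 * j + 1 ∧ 0 ∈ S ∧ ∀ k r : ℤ, r = m + 2 * k → 0 ≤ r →
      r ≤ 2 * (3 * j + 1) → 3 * j + 1 - r ∈ S ∧ 3 * (3 * j + 1 - r) ∈ S := by
  rcases Nat.even_or_odd' m with ⟨q, rfl | rfl⟩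
  · rcases Nat.even_or_odd' j with ⟨i, hi | hi⟩
    -- Here κ is odd and 0 must be added: 2(κ + 1) + 1 = 6j + 5 ≤ 8j + 1, as j is even and positive.
    · refine ⟨insert 0 ((Finset.Icc (0 : ℤ) (3 * j + 1)).image (fun t => 3 * j + 1 - 2 * t) ∪
        (Finset.Icc (0 : ℤ) (3 * j + 1)).image (fun t => 3 * (3 * j + 1 - 2 * t))), ?_,
        Finset.mem_insert_self _ _, fun k r hr h0 h1 => ⟨?_, ?_⟩⟩
      · refine (Finset.card_insert_le _ _).trans ?_
        have := (Finset.card_union_le _ _).trans (add_le_add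
          (Finset.card_image_le (s := Finset.Icc (0 : ℤ) (3 * j + 1))
            (f := fun t => 3 * j + 1 - 2 * t))
          (Finset.card_image_le (s := Finset.Icc (0 : ℤ) (3 * j + 1))
            (f := fun t => 3 * (3 * j + 1 - 2 * t))))
        simp only [Int.card_Icc] at this
        omega
      · refine Finset.mem_insert_of_mem (Finset.mem_union_left _
          (Finset.mem_image.2 ⟨q + k, Finset.mem_Icc.2 ?_, ?_⟩)) <;> push_cast at hr <;> omega
      · refine Finset.mem_insert_of_mem (Finset.mem_union_right _
          (Finset.mem_image.2 ⟨q + k, Finset.mem_Icc.2 ?_, ?_⟩)) <;> push_cast at hr <;> omega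
    -- Here κ = 2(3i + 2), so both families contain height 0. Erasing one copy leaves 6j + 3, which
    -- is sharp enough for j = 1.
    · refine ⟨(Finset.Icc (0 : ℤ) (3 * j + 1)).image (fun t => 3 * j + 1 - 2 * t) ∪
        ((Finset.Icc (0 : ℤ) (3 * j + 1)).erase (3 * i + 2)).image
          (fun t => 3 * (3 * j + 1 - 2 * t)), ?_,
        Finset.mem_union_left _ (Finset.mem_image.2 ⟨3 * i + 2, Finset.mem_Icc.2 ?_, ?_⟩),
        fun k r hr h0 h1 => ⟨?_, ?_⟩⟩
      · have := (Finset.card_union_le _ _).trans (add_le_add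
          (Finset.card_image_le (s := Finset.Icc (0 : ℤ) (3 * j + 1))
            (f := fun t => 3 * j + 1 - 2 * t))
          (Finset.card_image_le (s := (Finset.Icc (0 : ℤ) (3 * j + 1)).erase (3 * i + 2))
            (f := fun t => 3 * (3 * j + 1 - 2 * t))))
        rw [Finset.card_erase_of_mem (Finset.mem_Icc.2 (by omega))] at this
        simp only [Int.card_Icc] at this
        omega
      · omega
      · subst hi; push_cast; ring
      · refine Finset.mem_union_left _
          (Finset.mem_image.2 ⟨q + k, Finset.mem_Icc.2 ?_, ?_⟩) <;> push_cast at hr <;> omega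
      · by_cases h : (q + k : ℤ) = 3 * i + 2
        · refine Finset.mem_union_left _
            (Finset.mem_image.2 ⟨q + k, Finset.mem_Icc.2 ?_, ?_⟩) <;> push_cast at hr <;> omega
        · refine Finset.mem_union_right _ (Finset.mem_image.2
            ⟨q + k, Finset.mem_erase.2 ⟨h, Finset.mem_Icc.2 ?_⟩, ?_⟩) <;> push_cast at hr <;> omega
  -- For odd m there are only κ values of r, so the total is 2κ + 1 = 6j + 3.
  · refine ⟨insert 0 ((Finset.Ico (0 : ℤ) (3 * j + 1)).image (fun t => 3 * j - 2 * t) ∪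
      (Finset.Ico (0 : ℤ) (3 * j + 1)).image (fun t => 3 * (3 * j - 2 * t))), ?_,
      Finset.mem_insert_self _ _, fun k r hr h0 h1 => ⟨?_, ?_⟩⟩
    · refine (Finset.card_insert_le _ _).trans ?_
      have := (Finset.card_union_le _ _).trans (add_le_add
        (Finset.card_image_le (s := Finset.Ico (0 : ℤ) (3 * j + 1))
          (f := fun t => 3 * j - 2 * t))
        (Finset.card_image_le (s := Finset.Ico (0 : ℤ) (3 * j + 1))
          (f := fun t => 3 * (3 * j - 2 * t))))
      simp only [Int.card_Ico] at this
      omega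
    · refine Finset.mem_insert_of_mem (Finset.mem_union_left _
        (Finset.mem_image.2 ⟨q + k, Finset.mem_Ico.2 ?_, ?_⟩)) <;> push_cast at hr <;> omega
    · refine Finset.mem_insert_of_mem (Finset.mem_union_right _
        (Finset.mem_image.2 ⟨q + k, Finset.mem_Ico.2 ?_, ?_⟩)) <;> push_cast at hr <;> omega

theorem exists_tri_step_eq_int {κ : ℕ} (hκ : 0 < κ) (m i : ℕ) :
    ∃ k r : ℤ, r = m + 2 * k ∧ 0 ≤ r ∧ r ≤ 2 * κ ∧
      tri (step κ * (m - 2 * i)) = step κ * ((κ - r : ℤ) : ℝ) := by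
  obtain ⟨n, h1, h2⟩ := exists_tri_step_eq hκ (m - 2 * i)
  have e : (m - 2 * i - n * (4 * κ) : ℝ) = ((m - 2 * i - n * (4 * κ) : ℤ) : ℝ) := by push_cast; ring
  rw [e, ← Int.cast_abs] at h1 h2
  have h1 : |(m - 2 * i - n * (4 * κ) : ℤ)| ≤ 2 * κ := by exact_mod_cast h1
  rcases le_total 0 (m - 2 * i - n * (4 * κ) : ℤ) with h | h
  · refine ⟨-i - n * (2 * κ), |(m - 2 * i - n * (4 * κ) : ℤ)|, ?_, abs_nonneg _, h1, ?_⟩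
    · rw [abs_of_nonneg h]; ring
    · rw [h2]; push_cast; ring
  · refine ⟨-m + i + n * (2 * κ), |(m - 2 * i - n * (4 * κ) : ℤ)|, ?_, abs_nonneg _, h1, ?_⟩
    · rw [abs_of_nonpos h]; ring
    · rw [h2]; push_cast; ring

-- All the other radial lines contribute the single vertex `origin`; the remaining vertices have
-- heights in the set from `exists_finset_heights`.
open Classical in
theorem vertexCount_radialLine_le {j : ℕ} (hj : 1 ≤ j) (m : Fin (2 * (3 * j + 1))) :
    vertexCount (Finset.univ.image (member (3 * j + 1))) (member (3 * j + 1) (.inl m)) ≤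
      8 * j + 2 := by
  have hκ : 0 < 3 * j + 1 := by omega
  obtain ⟨S, hS, h0, hmem⟩ := exists_finset_heights hj (m : ℕ)
  set θ : ℝ := step (3 * j + 1) * (m : ℕ) with hθ
  refine (vertexCount_image_le
    (insert origin (S.image fun s : ℤ => polar θ (step (3 * j + 1) * s))) fun l' hne => ?_).trans
    ((Finset.card_insert_le _ _).trans (Nat.succ_le_succ (Finset.card_image_le.trans hS)))
  have hpolar : ∀ f : ℝ → ℝ, Function.Antiperiodic f π →
      radialLine θ ∩ polarCurve f ⊆ {polar θ (f θ)} := by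
    rintro f hf _ ⟨hp, ⟨φ, rfl⟩⟩
    obtain ⟨n, rfl⟩ := polar_mem_radialLine.1 hp
    exact (polar_apply_periodic hf).int_mul n θ
  rcases l' with m' | _ | ⟨b, i⟩
  · intro p hp
    obtain ⟨hp1, hp2⟩ := hp
    obtain rfl | ⟨φ, s, rfl⟩ := eq_origin_or_exists_polar p
    · exact Finset.mem_insert_self _ _
    · exfalso
      obtain ⟨x, rfl⟩ := exists_eq_step_mul hκ φ
      obtain ⟨n, hn⟩ := exists_eq_of_polar_mem_radialLine hκ hp1
      obtain ⟨n', hn'⟩ := exists_eq_of_polar_mem_radialLine hκ hp2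
      refine hne (congrArg _ (fin_eq_of_sub_eq (k := n - n') ?_).symm)
      push_cast at hn hn' ⊢
      linarith
  · refine (hpolar _ (wave_antiperiodic _ _)).trans (singleton_subset_iff.2 ?_)
    refine Finset.mem_insert_of_mem (Finset.mem_image.2 ⟨0, h0, ?_⟩)
    simp [wave]
  · refine (hpolar _ (wave_antiperiodic _ _)).trans (singleton_subset_iff.2 ?_)
    obtain ⟨k, r, hr, hr0, hr1, htri⟩ := exists_tri_step_eq_int hκ (m : ℕ) (i : ℕ)
    obtain ⟨ha, hb⟩ := hmem k r hr hr0 (by exact_mod_cast hr1)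
    rw [hθ, wave_step, htri]
    refine Finset.mem_insert_of_mem (Finset.mem_image.2 ?_)
    cases b
    · exact ⟨_, ha, by simp [amplitude]⟩
    · refine ⟨_, hb, ?_⟩
      congr 1
      simp only [amplitude, cond_true]
      push_cast
      ring

open Classical in
theorem exists_arrangement {j : ℕ} (hj : 1 ≤ j) :
    ∃ L : Finset (Set RealProjectivePlane),
      IsPseudolineArrangement L ∧ L.card = 18 * j + 7 ∧ ¬ IsPencil L ∧
        ∀ C ∈ L, vertexCount L C ≤ 8 * j + 2 := by
  have hκ : 0 < 3 * j + 1 := by omega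
  have hs := isSimpleClosedCurve_member (3 * j + 1)
  have hc := crossOnce_member hκ
  refine ⟨Finset.univ.image (member (3 * j + 1)), isPseudolineArrangement_image hs hc, ?_, ?_, ?_⟩
  · rw [Finset.card_image_of_injective _ (injective_of_crossOnce hs hc)]
    simp
    omega
  · rintro ⟨p, hp⟩
    have hp : ∀ l, p ∈ member (3 * j + 1) l := fun l => hp _ (Finset.mem_image_of_mem _ (by simp))
    have h0 : p ∈ polarCurve (wave 0 0) := hp (.inr none)
    obtain rfl | ⟨φ, s, rfl⟩ := eq_origin_or_exists_polar p
    · exact origin_notMem_polarCurve _ h0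
    · obtain ⟨x, rfl⟩ := exists_eq_step_mul hκ φ
      obtain ⟨n, hn⟩ := exists_eq_of_polar_mem_radialLine hκ (hp (.inl ⟨0, by omega⟩))
      obtain ⟨n', hn'⟩ := exists_eq_of_polar_mem_radialLine hκ (hp (.inl ⟨1, by omega⟩))
      have h : (0 : ℝ) + n * (2 * (3 * j + 1 : ℕ)) = 1 + n' * (2 * (3 * j + 1 : ℕ)) := by
        rw [hn'] at hn
        simpa using hn.symm
      have h : (0 : ℤ) + n * (2 * (3 * j + 1 : ℕ)) = 1 + n' * (2 * (3 * j + 1 : ℕ)) := by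
        exact_mod_cast h
      -- Directions 0 and 1 would agree modulo the even number 2κ, contradicting parity.
      have h : 2 * ((n - n') * (3 * j + 1 : ℕ)) = 1 := by linarith
      omega
  · intro C hC
    obtain ⟨l, -, rfl⟩ := Finset.mem_image.1 hC
    rcases l with m | _ | ⟨b, i⟩
    · exact vertexCount_radialLine_le hj m
    · exact vertexCount_infinity_le j
    · exact vertexCount_wave_le j b i

end PseudolineExample

theorem mainTheorem1 :
    (∀ j : ℕ, 1 ≤ j →
      ∃ L : Finset (Set RealProjectivePlane),
        IsPseudolineArrangement L ∧ L.card = 18 * j + 7 ∧ ¬ IsPencil L ∧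
        (∀ C ∈ L, vertexCount L C ≤ 8 * j + 2) ∧
        (8 * j + 2 : ℝ) = 4 * (L.card : ℝ) / 9 - 10 / 9) ∧
    ¬ ∃ c : ℝ, ∀ L : Finset (Set RealProjectivePlane),
        IsPseudolineArrangement L → ¬ IsPencil L →
        (L.card : ℝ) / 2 - c ≤ (maxVertexCount L : ℝ) := by
  constructor
  · intro j hj
    obtain ⟨L, hL, hcard, hpencil, hcount⟩ := PseudolineExample.exists_arrangement hj
    refine ⟨L, hL, hcard, hpencil, hcount, ?_⟩
    rw [hcard]
    push_cast
    ring
  · rintro ⟨c, hc⟩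
    obtain ⟨j, hj⟩ := exists_nat_ge c
    -- With J = j + 1 the gap n/2 - (8J + 2) is J + 3/2, which exceeds c.
    obtain ⟨L, hL, hcard, hpencil, hcount⟩ :=
      PseudolineExample.exists_arrangement (j := j + 1) (by omega)
    have h1 := hc L hL hpencil
    have h2 : (maxVertexCount L : ℝ) ≤ (8 * (j + 1) + 2 : ℕ) :=
      Nat.cast_le.2 (Finset.sup_le hcount)
    rw [hcard] at h1
    push_cast at h1 h2
    linarith
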